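/- Let $n,r\ge 1$ be integers, let $k$ be an algebraically closed field and let $V$ be an $r$-dimensional $k$-vector space. Let $\mathcal F$ be the variety of $n$-step flags $\{0\}=V_0\subseteq V_1\subseteq\cdots\subseteq V_n=V$ (inclusions not necessarily strict), that is, the disjoint union of the partial flag varieties of $V$. Let $\mathrm{GL}(V)$ act diagonally on $\mathcal F\times\mathcal F$, which carries the Zariski topology. Write $e_A$, $e_{A'}$, $\dots$ for the $\mathrm{GL}(V)$-orbits in $\mathcal F\times\mathcal F$, let $\Delta(p_1,p_2,p_3)=((p_1,p_2),(p_2,p_3))$ and $\pi(p_1,p_2,p_3)=(p_1,p_3)$ for $p_1,p_2,p_3\in\mathcal F$, and for two orbits $e_A,e_{A'}$ put $$S(A,A')=\pi\big(\Delta^{-1}(e_A\times e_{A'})\big)\subseteq\mathcal F\times\mathcal F .$$ 1. If $S(A,A')$ is non-empty, then its closure in $\mathcal F\times\mathcal F$ is irreducible, and exactly one $\mathrm{GL}(V)$-orbit contained in $S(A,A')$ is open in $S(A,A')$. 2. Let $G(n,r)$ be the free $\mathbb Z$-module on the set of $\mathrm{GL}(V)$-orbits in $\mathcal F\times\mathcal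 F$, and let $\star$ be the $\mathbb Z$-bilinear product on $G(n,r)$ for which $e_A\star e_{A'}$ is the open orbit in $S(A,A')$ if $S(A,A')\neq\emptyset$, and $e_A\star e_{A'}=0$ if $S(A,A')=\emptyset$. Then $\star$ is associative and has a two-sided identity element, so that $G(n,r)$ is an associative $\mathbb Z$-algebra. 3. The orbits form a multiplicative basis of $G(n,r)$: they are a $\mathbb Z$-basis, and the product of two of them is either zero or again one of them. -/

import Mathlib

namespace GenericAlgebra

/-! ### Zariski topologies -/

/-- Polynomial functions on a `k`-vector space `W`: the `k`-algebra of functions generated by the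
linear forms. -/
def polyFun (k W : Type*) [Field k] [AddCommGroup W] [Module k W] : Subalgebra k (W → k) :=
  Algebra.adjoin k (Set.range fun φ : Module.Dual k W => (φ : W → k))

/-- The Zariski topology of a (finite-dimensional) vector space, regarded as an affine space: the
non-vanishing loci of polynomial functions are a basis of open sets. -/
@[reducible]
def zariski (k W : Type*) [Field k] [AddCommGroup W] [Module k W] : TopologicalSpace W :=
  TopologicalSpace.generateFrom {U | ∃ p ∈ polyFun k W, U = {w | p w ≠ 0}}

/-- The general linear group of `V`. -/
abbrev GLin (k V : Type*) [Field k] [AddCommGroup V] [Module k V] :=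
  LinearMap.GeneralLinearGroup k V

/-- The Zariski topology of the algebraic group `GL(V) × GL(V)`, an open subset of the affine space
`End(V) × End(V)`. -/
@[reducible]
def zariskiGLGL (k V : Type*) [Field k] [AddCommGroup V] [Module k V] :
    TopologicalSpace (GLin k V × GLin k V) :=
  TopologicalSpace.induced
    (fun g => ((g.1 : Module.End k V), (g.2 : Module.End k V)))
    (zariski k (Module.End k V × Module.End k V))

/-! ### Flags -/

/-- The `n`-step flags `0 = V_0 ⊆ V_1 ⊆ ⋯ ⊆ V_n = V` (inclusions need not be strict). -/
@[ext]
structure Flag (k V : Type*) [Field k] [AddCommGroup V] [Module k V] (n : ℕ) where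
  /-- The subspaces `V_i`. -/
  space : Fin (n + 1) → Submodule k V
  mono : Monotone space
  space_zero : space 0 = ⊥
  space_last : space (Fin.last n) = ⊤

section

variable {k V : Type*} [Field k] [AddCommGroup V] [Module k V] {n : ℕ}

/-- `GL(V)` acts on flags by change of basis: `(g • f)_i = g(f_i)`. -/
instance : MulAction (GLin k V) (Flag k V n) where
  smul g f :=
    { space := fun i => (f.space i).map (g : Module.End k V)
      mono := fun _ _ h => Submodule.map_mono (f.mono h)
      space_zero := by rw [f.space_zero, Submodule.map_bot]
      space_last := by
        rw [f.space_last, Submodule.map_top, LinearMap.range_eq_top]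
        intro v
        refine ⟨((g⁻¹ : GLin k V) : Module.End k V) v, ?_⟩
        rw [← Module.End.mul_apply, ← Units.val_mul, mul_inv_cancel, Units.val_one,
          Module.End.one_apply] }
  one_smul f := Flag.ext (funext fun i => Submodule.map_id (f.space i))
  mul_smul g h f := Flag.ext (funext fun i =>
    Submodule.map_comp (h : Module.End k V) (g : Module.End k V) (f.space i))

end

/-- The set `F × F` of pairs of flags. -/
abbrev FlagPair (k V : Type*) [Field k] [AddCommGroup V] [Module k V] (n : ℕ) :=
  Flag k V n × Flag k V n

/-- The Zariski topology of the variety `F × F`. Here `F` is the disjoint union of the partial flag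
varieties `F_d = GL(V) / P_d`, so `F × F` is the disjoint union of the homogeneous spaces
`F_d × F_e = (GL(V) × GL(V)) / (P_d × P_e)`, each carrying the quotient of the Zariski topology of
`GL(V) × GL(V)`. Thus `U` is open iff for every base point `(f, f')` the set of those `(g, g')` with
`(g • f, g' • f') ∈ U` is Zariski open in `GL(V) × GL(V)`. -/
instance (k V : Type*) [Field k] [AddCommGroup V] [Module k V] (n : ℕ) :
    TopologicalSpace (FlagPair k V n) :=
  ⨆ x : FlagPair k V n,
    TopologicalSpace.coinduced (fun g : GLin k V × GLin k V => (g.1 • x.1, g.2 • x.2))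
      (zariskiGLGL k V)

/-- The set `(F × F) / GL(V)` of orbits of the diagonal action of `GL(V)` on `F × F`. For
`A : Orbit k V n` the orbit as a subset of `F × F` is `A.orbit`. -/
abbrev Orbit (k V : Type*) [Field k] [AddCommGroup V] [Module k V] (n : ℕ) :=
  MulAction.orbitRel.Quotient (GLin k V) (FlagPair k V n)

/-- The free `ℤ`-module `G(n, r)`, `r = dim V`, on the set of orbits. -/
abbrev G (k V : Type*) [Field k] [AddCommGroup V] [Module k V] (n : ℕ) :=
  Orbit k V n →₀ ℤ

section

variable {k V : Type*} [Field k] [AddCommGroup V] [Module k V] {n : ℕ}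

/-- `Δ(p₁, p₂, p₃) = ((p₁, p₂), (p₂, p₃))`. -/
def Delta (p : Flag k V n × Flag k V n × Flag k V n) : FlagPair k V n × FlagPair k V n :=
  ((p.1, p.2.1), (p.2.1, p.2.2))

/-- `π(p₁, p₂, p₃) = (p₁, p₃)`. -/
def proj (p : Flag k V n × Flag k V n × Flag k V n) : FlagPair k V n :=
  (p.1, p.2.2)

/-- `S(A, A') = π(Δ⁻¹(e_A × e_A'))`. -/
def S (A A' : Orbit k V n) : Set (FlagPair k V n) :=
  proj '' (Delta ⁻¹' (A.orbit ×ˢ A'.orbit))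

/-- The orbit `C` is contained in `S(A, A')` and open in `S(A, A')` for the subspace topology. -/
def IsOpenOrbit (A A' C : Orbit k V n) : Prop :=
  C.orbit ⊆ S A A' ∧ IsOpen ((↑) ⁻¹' C.orbit : Set (S A A'))

/-- The basis element `e_A` of `G(n, r)`. -/
noncomputable def e (A : Orbit k V n) : G k V n := Finsupp.single A 1

open Classical in
/-- `e_A ⋆ e_A'`: the open orbit of `S(A, A')` if there is one, and `0` otherwise. -/
noncomputable def starOrbit (A A' : Orbit k V n) : G k V n :=
  if h : ∃ C, IsOpenOrbit A A' C then e h.choose else 0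

/-- The product `⋆` of `G(n, r)`: the `ℤ`-bilinear extension of `e_A ⋆ e_A'`. -/
noncomputable def genericMul : G k V n →ₗ[ℤ] G k V n →ₗ[ℤ] G k V n :=
  Finsupp.linearCombination ℤ fun A => Finsupp.linearCombination ℤ fun A' => starOrbit A A'

end

end GenericAlgebra

open GenericAlgebra

/-! Everything rests on irreducibility and semicontinuity. Fix flags with `(f₁, f₂)`, `(f₂, f₃)`,
`(f₃, f₄)` in three given orbits. Every chain of four flags of these types is `(g f₁, g f₂, g h f₃,
g h h' f₄)` with `h` fixing `f₂` and `h'` fixing `f₃`. The triples `(g, h, h')` form the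
non-vanishing locus of a product of determinants in an affine space, hence an irreducible space over
an infinite field (`preirreducibleSpace_chainParam`). So `S A A'` is an image of an irreducible
space, and so is irreducible, as is its closure.

Orbits are classified by the dimensions of `V_i ∩ V'_j` (`orbit_eq_iff_relPos`), which are upper
semicontinuous (`isOpen_relPos_le`). Each dimension is minimal on a nonempty open part of `S A A'`;
by irreducibility these finitely many parts meet, and their intersection is one orbit. It is the
only open one, since nonempty open subsets meet.

For associativity, each bracketing imposes a nonempty open condition on chains of four flags. A
chain meeting both has its outer pair `(p₁, p₄)` in both resulting orbits, so they agree. The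
identity is the sum of the diagonal orbits. -/

namespace GenericAlgebra

open scoped Topology

/-! ### Polynomial functions and the Zariski topology -/

section PolynomialFunctions

variable {k W W' : Type*} [Field k] [AddCommGroup W] [Module k W] [AddCommGroup W'] [Module k W']

lemma dual_mem_polyFun (φ : Module.Dual k W) : (φ : W → k) ∈ polyFun k W :=
  Algebra.subset_adjoin ⟨φ, rfl⟩

/-- The restriction of a polynomial function to a line is a polynomial in one variable. -/
lemma exists_polynomial_line {p : W → k} (hp : p ∈ polyFun k W) (a b : W) :
    ∃ P : Polynomial k, ∀ t : k, p (a + t • b) = P.eval t := by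
  induction hp using Algebra.adjoin_induction with
  | mem x hx =>
    obtain ⟨φ, rfl⟩ := hx
    exact ⟨.C (φ a) + .X * .C (φ b), fun t => by
      simp only [map_add, map_smul, smul_eq_mul, Polynomial.eval_add, Polynomial.eval_mul,
        Polynomial.eval_C, Polynomial.eval_X]⟩
  | algebraMap r => exact ⟨.C r, fun t => by simp [Pi.algebraMap_apply]⟩
  | add x y _ _ hx hy =>
    obtain ⟨P, hP⟩ := hx
    obtain ⟨Q, hQ⟩ := hy
    exact ⟨P + Q, fun t => by simp [hP, hQ]⟩
  | mul x y _ _ hx hy =>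
    obtain ⟨P, hP⟩ := hx
    obtain ⟨Q, hQ⟩ := hy
    exact ⟨P * Q, fun t => by simp [hP, hQ]⟩

/-- Irreducibility of affine space: on the line through `a` and `b` both functions become nonzero
polynomials in one variable, and their product has a non-root because `k` is infinite. -/
lemma exists_common_nonvanishing [Infinite k] {p q : W → k} (hp : p ∈ polyFun k W)
    (hq : q ∈ polyFun k W) {a b : W} (ha : p a ≠ 0) (hb : q b ≠ 0) :
    ∃ w, p w ≠ 0 ∧ q w ≠ 0 := by
  obtain ⟨P, hP⟩ := exists_polynomial_line hp a (b - a)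
  obtain ⟨Q, hQ⟩ := exists_polynomial_line hq a (b - a)
  have hP0 : P ≠ 0 := by
    rintro rfl
    exact ha (by simpa using hP 0)
  have hQ0 : Q ≠ 0 := by
    rintro rfl
    exact hb (by simpa using hQ 1)
  by_contra! h
  refine mul_ne_zero hP0 hQ0 (Polynomial.funext fun t => ?_)
  rw [Polynomial.eval_mul, ← hP, ← hQ, Polynomial.eval_zero, mul_eq_zero]
  by_cases h0 : p (a + t • (b - a)) = 0
  · exact .inl h0
  · exact .inr (h _ h0)

/-- Non-vanishing loci are closed under finite intersection, by multiplying the functions, so the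
generating sets already form a basis. -/
lemma exists_polyFun_of_isOpen {U : Set W} (hU : IsOpen[zariski k W] U) {w : W} (hw : w ∈ U) :
    ∃ p ∈ polyFun k W, p w ≠ 0 ∧ ∀ x, p x ≠ 0 → x ∈ U := by
  induction hU with
  | basic s hs =>
    obtain ⟨p, hp, rfl⟩ := hs
    exact ⟨p, hp, hw, fun _ h => h⟩
  | univ => exact ⟨1, one_mem _, by simp, fun _ _ => trivial⟩
  | inter s t _ _ hs ht =>
    obtain ⟨p, hp, hpw, hps⟩ := hs hw.1
    obtain ⟨q, hq, hqw, hqt⟩ := ht hw.2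
    exact ⟨p * q, mul_mem hp hq, mul_ne_zero hpw hqw, fun x hx =>
      ⟨hps x (left_ne_zero_of_mul hx), hqt x (right_ne_zero_of_mul hx)⟩⟩
  | sUnion S _ hS =>
    obtain ⟨s, hsS, hws⟩ := hw
    obtain ⟨p, hp, hpw, hps⟩ := hS s hsS hws
    exact ⟨p, hp, hpw, fun x hx => ⟨s, hsS, hps x hx⟩⟩

lemma isOpen_of_forall_polyFun {U : Set W}
    (h : ∀ w ∈ U, ∃ p ∈ polyFun k W, p w ≠ 0 ∧ ∀ x, p x ≠ 0 → x ∈ U) :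
    IsOpen[zariski k W] U := by
  let _ := zariski k W
  refine isOpen_iff_forall_mem_open.2 fun w hw => ?_
  obtain ⟨p, hp, hpw, hpU⟩ := h w hw
  exact ⟨{x | p x ≠ 0}, hpU, .basic _ ⟨p, hp, rfl⟩, hpw⟩

/-- Maps between vector spaces that are given by polynomial functions. -/
def IsPolyMap (k : Type*) {W W' : Type*} [Field k] [AddCommGroup W] [Module k W]
    [AddCommGroup W'] [Module k W'] (f : W → W') : Prop :=
  ∀ φ : Module.Dual k W', (fun w => φ (f w)) ∈ polyFun k W

lemma IsPolyMap.comp_mem {f : W → W'} (hf : IsPolyMap k f) {p : W' → k} (hp : p ∈ polyFun k W') :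
    (fun w => p (f w)) ∈ polyFun k W := by
  induction hp using Algebra.adjoin_induction with
  | mem x hx =>
    obtain ⟨φ, rfl⟩ := hx
    exact hf φ
  | algebraMap r => exact (polyFun k W).algebraMap_mem r
  | add x y _ _ hx hy => exact add_mem hx hy
  | mul x y _ _ hx hy => exact mul_mem hx hy

lemma IsPolyMap.continuous {f : W → W'} (hf : IsPolyMap k f) :
    Continuous[zariski k W, zariski k W'] f := by
  refine continuous_generateFrom_iff.2 ?_
  rintro _ ⟨p, hp, rfl⟩
  exact .basic _ ⟨_, hf.comp_mem hp, rfl⟩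

lemma isPolyMap_linear (f : W →ₗ[k] W') : IsPolyMap k f := fun φ => dual_mem_polyFun (φ ∘ₗ f)

lemma IsPolyMap.prodMk {W'' : Type*} [AddCommGroup W''] [Module k W''] {f : W → W'} {g : W → W''}
    (hf : IsPolyMap k f) (hg : IsPolyMap k g) : IsPolyMap k fun w => (f w, g w) := by
  intro φ
  have : (fun w => φ (f w, g w)) =
      (fun w => (φ ∘ₗ LinearMap.inl k W' W'') (f w)) +
        fun w => (φ ∘ₗ LinearMap.inr k W' W'') (g w) := by
    funext w
    simp [← map_add]
  rw [this]
  exact add_mem (hf _) (hg _)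

lemma det_mem_polyFun {ι : Type*} [Fintype ι] [DecidableEq ι] {M : W → Matrix ι ι k}
    (hM : ∀ i j, (fun w => M w i j) ∈ polyFun k W) : (fun w => (M w).det) ∈ polyFun k W := by
  have : (fun w => (M w).det) = ∑ σ : Equiv.Perm ι,
      algebraMap k (W → k) ((σ.sign : ℤ) : k) * ∏ i, fun w => M w (σ i) i := by
    funext w
    simp [Matrix.det_apply', Finset.sum_apply, Finset.prod_apply]
  rw [this]
  exact sum_mem fun σ _ => mul_mem ((polyFun k W).algebraMap_mem _) (prod_mem fun i _ => hM _ _)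

section Endomorphisms

variable {V : Type*} [AddCommGroup V] [Module k V] [FiniteDimensional k V]

lemma IsPolyMap.mul {f g : W → Module.End k V} (hf : IsPolyMap k f) (hg : IsPolyMap k g) :
    IsPolyMap k fun w => f w * g w := by
  intro φ
  let b := Module.finBasis k (Module.End k V)
  have : (fun w => φ (f w * g w)) =
      ∑ i, (fun w => b.coord i (f w)) *
        fun w => (φ ∘ₗ LinearMap.mulLeft k (b i)) (g w) := by
    funext w
    conv_lhs => rw [← b.sum_repr (f w)]
    simp only [Finset.sum_mul, map_sum, smul_mul_assoc, map_smul, Finset.sum_apply, Pi.mul_apply,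
      LinearMap.comp_apply, LinearMap.mulLeft_apply, smul_eq_mul, Module.Basis.coord_apply]
  rw [this]
  exact sum_mem fun i _ => mul_mem (hf _) (hg _)

lemma IsPolyMap.det_mem {f : W → Module.End k V} (hf : IsPolyMap k f) :
    (fun w => LinearMap.det (f w)) ∈ polyFun k W := by
  let b := Module.finBasis k V
  have : (fun w => LinearMap.det (f w)) = fun w => (LinearMap.toMatrix b b (f w)).det := by
    funext w
    rw [LinearMap.det_toMatrix]
  rw [this]
  exact det_mem_polyFun fun i j =>
    hf (Matrix.entryLinearMap k k i j ∘ₗ (LinearMap.toMatrix b b).toLinearMap)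

/-- In a linear family of linear maps, having rank at least `c` is a Zariski open condition. -/
lemma isOpen_le_finrank_range {U : Type*} [AddCommGroup U] [Module k U]
    (M : W →ₗ[k] U →ₗ[k] V) (c : ℕ) :
    IsOpen[zariski k W] {w | c ≤ Module.finrank k (LinearMap.range (M w))} := by
  refine isOpen_of_forall_polyFun fun w hw => ?_
  obtain ⟨v, hv⟩ := exists_linearIndependent_of_le_finrank (R := k) hw
  choose u hu using fun i => (v i).2
  have hv' : LinearIndependent k (fun i => M w (u i)) := by
    simp only [hu]
    exact hv.map' _ (Submodule.ker_subtype _)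
  -- The matrix with entries `g (M x (u j)) i` is the identity at `x = w`. Wherever its determinant
  -- is nonzero, the `c` vectors `M x (u j)` remain independent, so the determinant is the required
  -- polynomial function.
  obtain ⟨g, hg⟩ := LinearMap.exists_leftInverse_of_injective
    (Fintype.linearCombination k fun i => M w (u i))
    (LinearMap.ker_eq_bot.2 hv'.fintypeLinearCombination_injective)
  have hgu : ∀ j, g (M w (u j)) = Pi.single j 1 := fun j => by
    simpa [Fintype.linearCombination_apply_single] using LinearMap.congr_fun hg (Pi.single j 1)
  refine ⟨fun x => (Matrix.of fun i j => g (M x (u j)) i).det, det_mem_polyFun fun i j =>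
    dual_mem_polyFun (LinearMap.proj i ∘ₗ g ∘ₗ LinearMap.applyₗ (u j) ∘ₗ M), ?_, fun x hx => ?_⟩
  · have : (Matrix.of fun i j => g (M w (u j)) i) = 1 := by
      ext i j
      simp [hgu, Matrix.one_apply, Pi.single_apply]
    simp [this]
  · have hli : LinearIndependent k fun j => M x (u j) :=
      LinearIndependent.of_comp g (Matrix.linearIndependent_cols_of_det_ne_zero hx)
    have h2 : LinearIndependent k fun j => (⟨M x (u j), u j, rfl⟩ : LinearMap.range (M x)) :=
      LinearIndependent.of_comp (LinearMap.range (M x)).subtype hli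
    simpa using h2.fintype_card_le_finrank

end Endomorphisms

end PolynomialFunctions

end GenericAlgebra

namespace GenericAlgebra

/-! ### Relative position of two chains of subspaces -/

section Chains

variable {k V V' : Type*} [Field k] [AddCommGroup V] [Module k V] [FiniteDimensional k V]
  [AddCommGroup V'] [Module k V'] [FiniteDimensional k V']

open Module (finrank)

lemma exists_compl_of_le {D M : Submodule k V} (h : D ≤ M) :
    ∃ C : Submodule k V, D ⊔ C = M ∧ finrank k C + finrank k D = finrank k M := by
  obtain ⟨C, hC⟩ := Submodule.exists_isCompl D
  have hsup : D ⊔ C ⊓ M = M := by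
    rw [← sup_inf_assoc_of_le C h, hC.sup_eq_top, top_inf_eq]
  have hinf : D ⊓ (C ⊓ M) = ⊥ := by
    rw [← inf_assoc, hC.inf_eq_bot, bot_inf_eq]
  refine ⟨C ⊓ M, hsup, ?_⟩
  have := Submodule.finrank_sup_add_finrank_inf_eq D (C ⊓ M)
  rw [hsup, hinf, finrank_bot] at this
  omega

/-- Two chains of subspaces admit a common decomposition into direct summands. -/
lemma exists_adapted_decomposition {p q : ℕ → Submodule k V} (hp : Monotone p) (hq : Monotone q)
    (hp0 : p 0 = ⊥) (hq0 : q 0 = ⊥) :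
    ∃ C : ℕ → ℕ → Submodule k V,
      (∀ i j, C i j ≤ p (i + 1) ⊓ q (j + 1)) ∧
      (∀ a b, p a ⊓ q b ≤ ⨆ i, ⨆ (_ : i < a), ⨆ j, ⨆ (_ : j < b), C i j) ∧
      ∀ i j, (finrank k (C i j) : ℤ) =
        (finrank k (p (i + 1) ⊓ q (j + 1) : Submodule k V) -
          finrank k (p (i + 1) ⊓ q j : Submodule k V)) -
        (finrank k (p i ⊓ q (j + 1) : Submodule k V) -
          finrank k (p i ⊓ q j : Submodule k V)) := by
  have hle : ∀ i j, p i ⊓ q (j + 1) ⊔ p (i + 1) ⊓ q j ≤ p (i + 1) ⊓ q (j + 1) := fun i j =>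
    sup_le (inf_le_inf_right _ (hp i.le_succ)) (inf_le_inf_left _ (hq j.le_succ))
  choose C hC hdim using fun i j => exists_compl_of_le (hle i j)
  refine ⟨C, fun i j => (hC i j) ▸ le_sup_right, fun a b => ?_, fun i j => ?_⟩
  · have hT : ∀ {a b i j}, i < a → j < b →
        C i j ≤ ⨆ i, ⨆ (_ : i < a), ⨆ j, ⨆ (_ : j < b), C i j := fun {a b i j} hi hj =>
      le_iSup₂_of_le i hi (le_iSup₂_of_le j hj le_rfl)
    -- The space `p (a + 1) ⊓ q (b + 1)` is spanned by `C a b` and two smaller intersections; the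
    -- outer hypothesis covers `p a ⊓ q (b + 1)`, the inner one `p (a + 1) ⊓ q b`.
    induction a generalizing b with
    | zero => simp [hp0]
    | succ a iha =>
      induction b with
      | zero => simp [hq0]
      | succ b ihb =>
        rw [← hC a b]
        refine sup_le (sup_le ((iha _).trans ?_) (ihb.trans ?_)) (hT a.lt_succ_self b.lt_succ_self)
        · exact iSup₂_le fun i hi => iSup₂_le fun j hj => hT (by omega) hj
        · exact iSup₂_le fun i hi => iSup₂_le fun j hj => hT hi (by omega)
  · have h1 := Submodule.finrank_sup_add_finrank_inf_eq (p i ⊓ q (j + 1)) (p (i + 1) ⊓ q j)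
    have h2 : p i ⊓ q (j + 1) ⊓ (p (i + 1) ⊓ q j) = p i ⊓ q j := by
      rw [inf_inf_inf_comm, inf_eq_left.2 (hp i.le_succ), inf_eq_right.2 (hq j.le_succ)]
    rw [h2] at h1
    have h3 := hdim i j
    omega

/-- A decomposition whose summands span and have dimensions adding up to `dim V` is direct. -/
lemma exists_linearEquiv_pi {ι : Type*} [Fintype ι] [DecidableEq ι] (C : ι → Submodule k V)
    (hspan : ⨆ x, C x = ⊤) (hdim : ∑ x, finrank k (C x) = finrank k V) :
    ∃ E : (∀ x, C x) ≃ₗ[k] V, ∀ x (c : C x), E (Pi.single x c) = c := by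
  let f : (∀ x, C x) →ₗ[k] V := LinearMap.lsum k (fun x => C x) k fun x => (C x).subtype
  have hf : ∀ x (c : C x), f (Pi.single x c) = c := fun x c => by
    exact LinearMap.lsum_piSingle k (fun x => C x) k _ x c
  have hsurj : Function.Surjective f := by
    rw [← LinearMap.range_eq_top, eq_top_iff, ← hspan]
    exact iSup_le fun x c hc => ⟨Pi.single x ⟨c, hc⟩, hf x ⟨c, hc⟩⟩
  have hinj : Function.Injective f :=
    (LinearMap.injective_iff_surjective_of_finrank_eq_finrank
      (by rw [Module.finrank_pi_fintype, hdim])).2 hsurj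
  exact ⟨LinearEquiv.ofBijective f ⟨hinj, hsurj⟩, hf⟩

/-- The summands of a common decomposition of two chains, glued along the summation map. -/
lemma exists_adapted_linearEquiv {p q : ℕ → Submodule k V} (hp : Monotone p) (hq : Monotone q)
    (hp0 : p 0 = ⊥) (hq0 : q 0 = ⊥) {N : ℕ} (hpN : p N = ⊤) (hqN : q N = ⊤) :
    ∃ C : ℕ → ℕ → Submodule k V,
      (∀ i j, C i j ≤ p (i + 1) ⊓ q (j + 1)) ∧
      (∀ a b, p a ⊓ q b ≤ ⨆ i, ⨆ (_ : i < a), ⨆ j, ⨆ (_ : j < b), C i j) ∧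
      (∀ i j, (finrank k (C i j) : ℤ) =
        (finrank k (p (i + 1) ⊓ q (j + 1) : Submodule k V) -
          finrank k (p (i + 1) ⊓ q j : Submodule k V)) -
        (finrank k (p i ⊓ q (j + 1) : Submodule k V) -
          finrank k (p i ⊓ q j : Submodule k V))) ∧
      ∃ E : (∀ x : Fin N × Fin N, C x.1 x.2) ≃ₗ[k] V, ∀ x (c : C x.1 x.2),
        E (Pi.single x c) = c := by
  obtain ⟨C, hC, hspan, hdim⟩ := exists_adapted_decomposition hp hq hp0 hq0
  refine ⟨C, hC, hspan, hdim,
    exists_linearEquiv_pi (fun x : Fin N × Fin N => C x.1 x.2) ?_ ?_⟩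
  · rw [eq_top_iff]
    calc ⊤ = p N ⊓ q N := by rw [hpN, hqN, inf_top_eq]
      _ ≤ _ := hspan N N
      _ ≤ _ := iSup₂_le fun i hi => iSup₂_le fun j hj =>
        le_iSup (fun x : Fin N × Fin N => C x.1 x.2) (⟨i, hi⟩, ⟨j, hj⟩)
  -- The dimensions of the summands are second differences, so the double sum telescopes, first
  -- along `j` and then along `i`.
  · zify
    have hrow : ∀ i, ∑ j : Fin N, (finrank k (C i j) : ℤ) =
        (finrank k (p (i + 1)) : ℤ) - finrank k (p i) := fun i => by
      rw [Fin.sum_univ_eq_sum_range (fun j => (finrank k (C i j) : ℤ))]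
      simp only [hdim]
      rw [Finset.sum_sub_distrib, Finset.sum_range_sub (fun j =>
        (finrank k (p (i + 1) ⊓ q j : Submodule k V) : ℤ)), Finset.sum_range_sub (fun j =>
        (finrank k (p i ⊓ q j : Submodule k V) : ℤ))]
      rw [hq0, hqN]
      rw [inf_top_eq, inf_top_eq, inf_bot_eq, inf_bot_eq, finrank_bot]
      simp
    simp only [Fintype.sum_prod_type, hrow]
    rw [Fin.sum_univ_eq_sum_range (fun i => (finrank k (p (i + 1)) : ℤ) - finrank k (p i)),
      Finset.sum_range_sub (fun i => (finrank k (p i) : ℤ)), hp0, hpN]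
    simp

/-- Pairs of chains of subspaces with the same relative position are isomorphic. -/
theorem exists_linearEquiv_map_chains {p q : ℕ → Submodule k V} {p' q' : ℕ → Submodule k V'}
    (hp : Monotone p) (hq : Monotone q) (hp' : Monotone p') (hq' : Monotone q')
    (hp0 : p 0 = ⊥) (hq0 : q 0 = ⊥) (hp0' : p' 0 = ⊥) (hq0' : q' 0 = ⊥)
    {N : ℕ} (hpN : p N = ⊤) (hqN : q N = ⊤) (hpN' : p' N = ⊤) (hqN' : q' N = ⊤)
    (h : ∀ i j, finrank k (p i ⊓ q j : Submodule k V) = finrank k (p' i ⊓ q' j : Submodule k V')) :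
    ∃ g : V ≃ₗ[k] V', ∀ i ≤ N, (p i).map (g : V →ₗ[k] V') = p' i ∧
      (q i).map (g : V →ₗ[k] V') = q' i := by
  obtain ⟨C, -, hspan, hdim, E, hE⟩ := exists_adapted_linearEquiv hp hq hp0 hq0 hpN hqN
  obtain ⟨C', hC', -, hdim', E', hE'⟩ := exists_adapted_linearEquiv hp' hq' hp0' hq0' hpN' hqN'
  have hCC : ∀ i j, finrank k (C i j) = finrank k (C' i j) := fun i j => by
    zify
    rw [hdim, hdim', h, h, h, h]
  let g : V ≃ₗ[k] V' := E.symm ≪≫ₗ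
    LinearEquiv.piCongrRight (fun x => LinearEquiv.ofFinrankEq _ _ (hCC x.1 x.2)) ≪≫ₗ E'
  have hg : ∀ i < N, ∀ j < N, (C i j).map (g : V →ₗ[k] V') ≤ C' i j := by
    rintro i hi j hj _ ⟨c, hc, rfl⟩
    have : E.symm c = Pi.single (⟨i, hi⟩, ⟨j, hj⟩) ⟨c, hc⟩ := by
      rw [LinearEquiv.symm_apply_eq]
      exact (hE (⟨i, hi⟩, ⟨j, hj⟩) ⟨c, hc⟩).symm
    have hgc : g c = E' (Pi.single (⟨i, hi⟩, ⟨j, hj⟩)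
        (LinearEquiv.ofFinrankEq _ _ (hCC i j) ⟨c, hc⟩)) := by
      simp only [g, LinearEquiv.trans_apply, this]
      congr 1
      funext x
      rw [LinearEquiv.piCongrRight_apply]
      exact Pi.apply_single (fun x : Fin N × Fin N =>
        LinearEquiv.ofFinrankEq (C x.1 x.2) (C' x.1 x.2) (hCC x.1 x.2))
        (fun x => map_zero _) _ _ _
    rw [LinearEquiv.coe_coe, hgc, hE']
    exact SetLike.coe_mem _
  -- The summands give only an inclusion; equality of dimensions makes it an equality. Setting one
  -- index to `N`, where the chains are `⊤`, then recovers each chain separately.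
  have hM : ∀ a ≤ N, ∀ b ≤ N, (p a ⊓ q b).map (g : V →ₗ[k] V') = p' a ⊓ q' b := by
    intro a ha b hb
    refine Submodule.eq_of_le_of_finrank_eq ?_ (by rw [LinearEquiv.finrank_map_eq, h])
    refine (Submodule.map_mono (hspan a b)).trans ?_
    simp only [Submodule.map_iSup]
    refine iSup₂_le fun i hi => iSup₂_le fun j hj => ?_
    exact (hg i (by omega) j (by omega)).trans ((hC' i j).trans (inf_le_inf (hp' hi) (hq' hj)))
  refine ⟨g, fun i hi => ⟨?_, ?_⟩⟩
  · simpa [hqN, hqN'] using hM i hi N le_rfl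
  · simpa [hpN, hpN'] using hM N le_rfl i hi

end Chains

/-! ### Classification of orbits by relative position -/

section Orbits

variable {k V : Type*} [Field k] [AddCommGroup V] [Module k V] {n : ℕ}

open Module (finrank)

/-- The relative position of two flags: the dimensions of the intersections of their subspaces. -/
noncomputable def relPos (x : FlagPair k V n) (i j : Fin (n + 1)) : ℕ :=
  finrank k (x.1.space i ⊓ x.2.space j : Submodule k V)

lemma GLin.injective (g : GLin k V) : Function.Injective (g : Module.End k V) :=
  (LinearMap.GeneralLinearGroup.toLinearEquiv g).injective

lemma relPos_smul (g : GLin k V) (x : FlagPair k V n) : relPos (g • x) = relPos x := by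
  funext i j
  have : (g • x).1.space i ⊓ (g • x).2.space j =
      (x.1.space i ⊓ x.2.space j).map (g : Module.End k V) :=
    (Submodule.map_inf _ g.injective).symm
  rw [relPos, this]
  exact LinearEquiv.finrank_map_eq (LinearMap.GeneralLinearGroup.toLinearEquiv g) _

/-- The subspaces of a flag, indexed by all natural numbers. -/
def Flag.chain (f : Flag k V n) (i : ℕ) : Submodule k V :=
  f.space ⟨min i n, by omega⟩

lemma Flag.chain_mono (f : Flag k V n) : Monotone f.chain := fun i j h =>
  f.mono (Fin.mk_le_mk.2 (by omega))

lemma Flag.chain_zero (f : Flag k V n) : f.chain 0 = ⊥ := by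
  rw [← f.space_zero]
  exact congrArg f.space (Fin.ext (by simp))

lemma Flag.chain_last (f : Flag k V n) : f.chain n = ⊤ := by
  rw [← f.space_last]
  exact congrArg f.space (Fin.ext (by simp))

lemma Flag.chain_val (f : Flag k V n) (i : Fin (n + 1)) : f.chain i = f.space i :=
  congrArg f.space (Fin.ext (by simp; omega))

lemma mem_orbit_iff {A : Orbit k V n} {x : FlagPair k V n} :
    x ∈ A.orbit ↔ (Quotient.mk'' x : Orbit k V n) = A :=
  MulAction.orbitRel.Quotient.mem_orbit

variable [FiniteDimensional k V]

theorem exists_smul_eq_of_relPos_eq {x y : FlagPair k V n} (h : relPos x = relPos y) :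
    ∃ g : GLin k V, g • x = y := by
  obtain ⟨g, hg⟩ := exists_linearEquiv_map_chains x.1.chain_mono x.2.chain_mono y.1.chain_mono
    y.2.chain_mono x.1.chain_zero x.2.chain_zero y.1.chain_zero y.2.chain_zero x.1.chain_last
    x.2.chain_last y.1.chain_last y.2.chain_last fun i j => congrFun (congrFun h _) _
  refine ⟨.ofLinearEquiv g, Prod.ext (Flag.ext (funext fun i => ?_))
    (Flag.ext (funext fun i => ?_))⟩
  · rw [← Flag.chain_val y.1, ← (hg i (by omega)).1, Flag.chain_val]
    rfl
  · rw [← Flag.chain_val y.2, ← (hg i (by omega)).2, Flag.chain_val]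
    rfl

lemma orbit_eq_iff_relPos {x y : FlagPair k V n} :
    (Quotient.mk'' x : Orbit k V n) = Quotient.mk'' y ↔ relPos x = relPos y := by
  rw [Quotient.eq'', MulAction.orbitRel_apply]
  constructor
  · rintro ⟨g, rfl⟩
    exact relPos_smul g y
  · intro h
    exact exists_smul_eq_of_relPos_eq h.symm

instance : Finite (Orbit k V n) := by
  have hb : ∀ (x : FlagPair k V n) i j, relPos x i j < finrank k V + 1 := fun x i j =>
    Nat.lt_succ_of_le (Submodule.finrank_le _)
  refine Finite.of_injective (β := Fin (n + 1) → Fin (n + 1) → Fin (finrank k V + 1))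
    (fun A => fun i j => ⟨relPos A.out i j, hb _ i j⟩) fun A B h => ?_
  rw [← A.out_eq', ← B.out_eq']
  refine orbit_eq_iff_relPos.2 ?_
  funext i j
  exact congrArg Fin.val (congrFun (congrFun h i) j)

end Orbits

end GenericAlgebra

namespace GenericAlgebra

open scoped Topology

/-! ### Irreducible parameter space for chains of flags, and semicontinuity -/

section Parametrization

variable {k V : Type*} [Field k] [AddCommGroup V] [Module k V] {n : ℕ}

open Module (finrank)

/-- The endomorphisms that map every subspace of a flag into itself. -/
def Flag.preservers (f : Flag k V n) : Submodule k (Module.End k V) where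
  carrier := {h | ∀ i, ∀ v ∈ f.space i, h v ∈ f.space i}
  add_mem' ha hb i v hv := add_mem (ha i v hv) (hb i v hv)
  zero_mem' i _ _ := zero_mem (f.space i)
  smul_mem' c _ ha i v hv := Submodule.smul_mem _ c (ha i v hv)

lemma Flag.coe_mem_preservers {f : Flag k V n} {g : GLin k V}
    (hg : g ∈ MulAction.stabilizer (GLin k V) f) : (g : Module.End k V) ∈ f.preservers := by
  intro i v hv
  have : (g • f).space i = f.space i := by rw [MulAction.mem_stabilizer_iff.1 hg]
  rw [← this]
  exact ⟨v, hv, rfl⟩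

/-- The group elements that move a flag `f₂` to the second member of a chain, and change the two
following members. -/
abbrev ChainParam (f f' : Flag k V n) :=
  GLin k V × MulAction.stabilizer (GLin k V) f × MulAction.stabilizer (GLin k V) f'

/-- The affine space in which `ChainParam f f'` is open. -/
abbrev ChainSpace (f f' : Flag k V n) :=
  Module.End k V × f.preservers × f'.preservers

/-- The inclusion of `ChainParam f f'` into `ChainSpace f f'`. -/
def chainCoord (f f' : Flag k V n) (t : ChainParam f f') : ChainSpace f f' :=
  (t.1, ⟨(t.2.1 : GLin k V), Flag.coe_mem_preservers t.2.1.2⟩,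
    ⟨(t.2.2 : GLin k V), Flag.coe_mem_preservers t.2.2.2⟩)

/-- The Zariski topology of the group variety `ChainParam f f'`. -/
@[reducible]
def chainTopology (f f' : Flag k V n) : TopologicalSpace (ChainParam f f') :=
  TopologicalSpace.induced (chainCoord f f') (zariski k (ChainSpace f f'))

lemma isPolyMap_coord_one (f f' : Flag k V n) :
    IsPolyMap k fun w : ChainSpace f f' => w.1 :=
  isPolyMap_linear (LinearMap.fst k (Module.End k V) (f.preservers × f'.preservers))

lemma isPolyMap_coord_two (f f' : Flag k V n) :
    IsPolyMap k fun w : ChainSpace f f' => (w.2.1 : Module.End k V) :=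
  isPolyMap_linear (f.preservers.subtype ∘ₗ LinearMap.fst k f.preservers f'.preservers ∘ₗ
    LinearMap.snd k (Module.End k V) (f.preservers × f'.preservers))

lemma isPolyMap_coord_three (f f' : Flag k V n) :
    IsPolyMap k fun w : ChainSpace f f' => (w.2.2 : Module.End k V) :=
  isPolyMap_linear (f'.preservers.subtype ∘ₗ LinearMap.snd k f.preservers f'.preservers ∘ₗ
    LinearMap.snd k (Module.End k V) (f.preservers × f'.preservers))

lemma continuous_smul_flagPair (x : FlagPair k V n) :
    Continuous[zariskiGLGL k V, inferInstance]
      fun g : GLin k V × GLin k V => (g.1 • x.1, g.2 • x.2) :=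
  continuous_iff_coinduced_le.2 (le_iSup (fun x : FlagPair k V n =>
    TopologicalSpace.coinduced (fun g : GLin k V × GLin k V => (g.1 • x.1, g.2 • x.2))
      (zariskiGLGL k V)) x)

/-- The topology on pairs of flags makes the orbit maps from `GL(V) × GL(V)` continuous, so it
suffices that the two group elements depend polynomially on the parameter. -/
lemma continuous_chainParam {f f' : Flag k V n} {a b : ChainParam f f' → GLin k V}
    {α β : ChainSpace f f' → Module.End k V} (hα : IsPolyMap k α) (hβ : IsPolyMap k β)
    (ha : ∀ t, (a t : Module.End k V) = α (chainCoord f f' t))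
    (hb : ∀ t, (b t : Module.End k V) = β (chainCoord f f' t)) (x y : Flag k V n) :
    Continuous[chainTopology f f', inferInstance]
      fun t => ((a t • x, b t • y) : FlagPair k V n) := by
  let _ := chainTopology f f'
  let _ := zariskiGLGL k V
  let _ := zariski k (ChainSpace f f')
  let _ := zariski k (Module.End k V × Module.End k V)
  have h : Continuous fun t => (a t, b t) := by
    refine continuous_induced_rng.2 ?_
    have := (hα.prodMk hβ).continuous.comp (continuous_induced_dom (f := chainCoord f f'))
    refine this.congr fun t => ?_
    simp [ha, hb]
  exact (continuous_smul_flagPair (x, y)).comp h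

lemma continuous_chain_one_three [FiniteDimensional k V] {f₂ f₃ : Flag k V n} (f₁ x : Flag k V n) :
    Continuous[chainTopology f₂ f₃, inferInstance] fun t : ChainParam f₂ f₃ =>
      ((t.1 • f₁, (t.1 * (t.2.1 : GLin k V)) • x) : FlagPair k V n) := by
  have h := isPolyMap_coord_one f₂ f₃
  exact continuous_chainParam h (h.mul (isPolyMap_coord_two f₂ f₃))
    (fun _ => rfl) (fun _ => rfl) f₁ x

lemma continuous_chain_one_four [FiniteDimensional k V] {f₂ f₃ : Flag k V n} (f₁ x : Flag k V n) :
    Continuous[chainTopology f₂ f₃, inferInstance] fun t : ChainParam f₂ f₃ =>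
      ((t.1 • f₁, (t.1 * (t.2.1 : GLin k V) * (t.2.2 : GLin k V)) • x) : FlagPair k V n) := by
  have h := isPolyMap_coord_one f₂ f₃
  exact continuous_chainParam h
    ((h.mul (isPolyMap_coord_two f₂ f₃)).mul (isPolyMap_coord_three f₂ f₃))
    (fun _ => rfl) (fun _ => rfl) f₁ x

variable [FiniteDimensional k V]

lemma exists_GLin_of_det_ne_zero {h : Module.End k V} (hh : LinearMap.det h ≠ 0) :
    ∃ g : GLin k V, (g : Module.End k V) = h :=
  (LinearMap.isUnit_iff_isUnit_det h).2 (isUnit_iff_ne_zero.2 hh)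

lemma det_GLin_ne_zero (g : GLin k V) : LinearMap.det (g : Module.End k V) ≠ 0 :=
  ((LinearMap.isUnit_iff_isUnit_det _).1 g.isUnit).ne_zero

/-- An injective endomorphism mapping a finite-dimensional subspace into itself maps it onto itself.
Hence the stabilizer is the locus `det ≠ 0` in the linear space `f.preservers`. -/
lemma Flag.exists_stabilizer_of_det_ne_zero {f : Flag k V n} (h : f.preservers)
    (hh : LinearMap.det (h : Module.End k V) ≠ 0) :
    ∃ g : MulAction.stabilizer (GLin k V) f, ((g : GLin k V) : Module.End k V) = h := by
  obtain ⟨g, hg⟩ := exists_GLin_of_det_ne_zero hh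
  refine ⟨⟨g, MulAction.mem_stabilizer_iff.2 (Flag.ext (funext fun i => ?_))⟩, hg⟩
  refine Submodule.eq_of_le_of_finrank_eq ?_
    (LinearEquiv.finrank_map_eq (LinearMap.GeneralLinearGroup.toLinearEquiv g) _)
  rintro _ ⟨v, hv, rfl⟩
  rw [hg]
  exact h.2 i v hv

theorem preirreducibleSpace_chainParam [Infinite k] (f f' : Flag k V n) :
    @PreirreducibleSpace _ (chainTopology f f') := by
  let _ := chainTopology f f'
  let d : ChainSpace f f' → k := fun w => LinearMap.det w.1 *
    LinearMap.det (w.2.1 : Module.End k V) * LinearMap.det (w.2.2 : Module.End k V)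
  have hd : d ∈ polyFun k (ChainSpace f f') :=
    mul_mem (mul_mem (isPolyMap_coord_one f f').det_mem
      (isPolyMap_coord_two f f').det_mem)
      (isPolyMap_coord_three f f').det_mem
  have hdt : ∀ t, d (chainCoord f f' t) ≠ 0 := fun t =>
    mul_ne_zero (mul_ne_zero (det_GLin_ne_zero _) (det_GLin_ne_zero _)) (det_GLin_ne_zero _)
  refine ⟨?_⟩
  rintro _ _ ⟨U, hU, rfl⟩ ⟨U', hU', rfl⟩ ⟨t, -, ht⟩ ⟨t', -, ht'⟩
  obtain ⟨p, hp, hpt, hpU⟩ := exists_polyFun_of_isOpen hU ht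
  obtain ⟨q, hq, hqt, hqU⟩ := exists_polyFun_of_isOpen hU' ht'
  -- The factor `d` forces all three components of `w` to be invertible, so that `w` comes from a
  -- point of `ChainParam f f'`.
  obtain ⟨w, hw, hqw⟩ := exists_common_nonvanishing (mul_mem hp hd) hq
    (mul_ne_zero hpt (hdt t)) hqt
  have hpw : p w ≠ 0 := left_ne_zero_of_mul hw
  have hdw : d w ≠ 0 := right_ne_zero_of_mul hw
  obtain ⟨g, hg⟩ := exists_GLin_of_det_ne_zero (left_ne_zero_of_mul (left_ne_zero_of_mul hdw))
  obtain ⟨h, hh⟩ := Flag.exists_stabilizer_of_det_ne_zero _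
    (right_ne_zero_of_mul (left_ne_zero_of_mul hdw))
  obtain ⟨h', hh'⟩ := Flag.exists_stabilizer_of_det_ne_zero _ (right_ne_zero_of_mul hdw)
  have hwt : chainCoord f f' (g, h, h') = w :=
    Prod.ext hg (Prod.ext (Subtype.ext hh) (Subtype.ext hh'))
  refine ⟨(g, h, h'), trivial, ?_, ?_⟩
  · exact hpU _ (by rwa [hwt])
  · exact hqU _ (by rwa [hwt])

/-- Upper semicontinuity of the relative position. -/
lemma isOpen_relPos_le (i j : Fin (n + 1)) (d : ℕ) :
    IsOpen {x : FlagPair k V n | relPos x i j ≤ d} := by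
  refine isOpen_iSup_iff.2 fun x => isOpen_coinduced.2
    ((@isOpen_induced_iff _ _ (zariski k (Module.End k V × Module.End k V)) _ _).2 ?_)
  let M : (Module.End k V × Module.End k V) →ₗ[k] (x.1.space i × x.2.space j) →ₗ[k] V :=
    LinearMap.mk₂ k (fun w u => w.1 u.1 + w.2 u.2)
      (fun _ _ _ => by simp; abel) (fun _ _ _ => by simp) (fun _ _ _ => by simp; abel)
      (fun _ _ _ => by simp)
  -- The range of `M` is the sum of the two moved subspaces, whose dimensions are fixed, so a small
  -- intersection means a large sum. When `d` exceeds the total, the truncated bound is `0` and both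
  -- conditions hold.
  refine ⟨_, isOpen_le_finrank_range M (finrank k (x.1.space i) + finrank k (x.2.space j) - d), ?_⟩
  ext g
  have hrange : LinearMap.range (M ((g.1 : Module.End k V), (g.2 : Module.End k V))) =
      (g.1 • x.1).space i ⊔ (g.2 • x.2).space j := by
    ext v
    rw [Submodule.mem_sup]
    constructor
    · rintro ⟨u, rfl⟩
      exact ⟨_, ⟨u.1, u.1.2, rfl⟩, _, ⟨u.2, u.2.2, rfl⟩, rfl⟩
    · rintro ⟨_, ⟨a, ha, rfl⟩, _, ⟨b, hb, rfl⟩, rfl⟩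
      exact ⟨(⟨a, ha⟩, ⟨b, hb⟩), rfl⟩
  have h1 : finrank k ((g.1 • x.1).space i) = finrank k (x.1.space i) :=
    LinearEquiv.finrank_map_eq (LinearMap.GeneralLinearGroup.toLinearEquiv g.1) _
  have h2 : finrank k ((g.2 • x.2).space j) = finrank k (x.2.space j) :=
    LinearEquiv.finrank_map_eq (LinearMap.GeneralLinearGroup.toLinearEquiv g.2) _
  have h3 := Submodule.finrank_sup_add_finrank_inf_eq ((g.1 • x.1).space i) ((g.2 • x.2).space j)
  change _ ≤ finrank k (LinearMap.range (M ((g.1 : Module.End k V), (g.2 : Module.End k V)))) ↔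
    finrank k ((g.1 • x.1).space i ⊓ (g.2 • x.2).space j : Submodule k V) ≤ d
  rw [hrange]
  omega

end Parametrization

/-! ### Existence, uniqueness and associativity of open orbits -/

section OpenOrbits

variable {k V : Type*} [Field k] [AddCommGroup V] [Module k V] {n : ℕ}

lemma exists_smul_eq_of_mem_orbit {A : Orbit k V n} {x y : FlagPair k V n} (hx : x ∈ A.orbit)
    (hy : y ∈ A.orbit) : ∃ g : GLin k V, g • x = y := by
  rw [mem_orbit_iff] at hx hy
  exact MulAction.orbitRel_apply.1 (Quotient.eq''.1 (hy.trans hx.symm))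

lemma orbit_nonempty (A : Orbit k V n) : A.orbit.Nonempty :=
  ⟨A.out, mem_orbit_iff.2 A.out_eq'⟩

lemma smul_mem_orbit {A : Orbit k V n} {x : FlagPair k V n} (g : GLin k V) (hx : x ∈ A.orbit) :
    g • x ∈ A.orbit := by
  rw [mem_orbit_iff] at hx ⊢
  rw [← hx]
  exact Quotient.eq''.2 (MulAction.mem_orbit x g)

lemma eq_of_mem_orbit {A B : Orbit k V n} {x : FlagPair k V n} (hA : x ∈ A.orbit)
    (hB : x ∈ B.orbit) : A = B :=
  (mem_orbit_iff.1 hA).symm.trans (mem_orbit_iff.1 hB)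

lemma mem_S_iff {A A' : Orbit k V n} {p q : Flag k V n} :
    (p, q) ∈ S A A' ↔ ∃ m, (p, m) ∈ A.orbit ∧ (m, q) ∈ A'.orbit := by
  constructor
  · rintro ⟨⟨p', m, q'⟩, ⟨h1, h2⟩, h⟩
    cases h
    exact ⟨m, h1, h2⟩
  · rintro ⟨m, h1, h2⟩
    exact ⟨(p, m, q), ⟨h1, h2⟩, rfl⟩

lemma smul_mem_S {A A' : Orbit k V n} {x : FlagPair k V n} (g : GLin k V) (hx : x ∈ S A A') :
    g • x ∈ S A A' := by
  obtain ⟨m, h1, h2⟩ := mem_S_iff.1 hx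
  exact mem_S_iff.2 ⟨g • m, smul_mem_orbit g h1, smul_mem_orbit g h2⟩

lemma orbit_subset_S {A A' C : Orbit k V n} {x : FlagPair k V n} (hx : x ∈ S A A')
    (hC : x ∈ C.orbit) : C.orbit ⊆ S A A' := by
  intro y hy
  obtain ⟨g, rfl⟩ := exists_smul_eq_of_mem_orbit hC hy
  exact smul_mem_S g hx

section Chains

variable {A A' A'' : Orbit k V n} {f₁ f₂ f₃ f₄ : Flag k V n}

lemma chain_mem_orbits (h12 : (f₁, f₂) ∈ A.orbit) (h23 : (f₂, f₃) ∈ A'.orbit)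
    (h34 : (f₃, f₄) ∈ A''.orbit) (t : ChainParam f₂ f₃) :
    (t.1 • f₁, t.1 • f₂) ∈ A.orbit ∧ (t.1 • f₂, (t.1 * (t.2.1 : GLin k V)) • f₃) ∈ A'.orbit ∧
      ((t.1 * (t.2.1 : GLin k V)) • f₃, (t.1 * (t.2.1 : GLin k V) * (t.2.2 : GLin k V)) • f₄) ∈ A''.orbit := by
  refine ⟨smul_mem_orbit t.1 h12, ?_, ?_⟩
  · have := smul_mem_orbit (t.1 * (t.2.1 : GLin k V)) h23
    rwa [Prod.smul_mk, mul_smul t.1 _ f₂, MulAction.mem_stabilizer_iff.1 t.2.1.2] at this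
  · have := smul_mem_orbit (t.1 * (t.2.1 : GLin k V) * (t.2.2 : GLin k V)) h34
    rwa [Prod.smul_mk, mul_smul (t.1 * (t.2.1 : GLin k V) : GLin k V) _ f₃,
      MulAction.mem_stabilizer_iff.1 t.2.2.2] at this

lemma exists_chainParam (h12 : (f₁, f₂) ∈ A.orbit) (h23 : (f₂, f₃) ∈ A'.orbit)
    (h34 : (f₃, f₄) ∈ A''.orbit) {q₁ q₂ q₃ q₄ : Flag k V n} (k12 : (q₁, q₂) ∈ A.orbit)
    (k23 : (q₂, q₃) ∈ A'.orbit) (k34 : (q₃, q₄) ∈ A''.orbit) :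
    ∃ t : ChainParam f₂ f₃, t.1 • f₁ = q₁ ∧ t.1 • f₂ = q₂ ∧ (t.1 * (t.2.1 : GLin k V)) • f₃ = q₃ ∧
      (t.1 * (t.2.1 : GLin k V) * (t.2.2 : GLin k V)) • f₄ = q₄ := by
  obtain ⟨g, hg⟩ := exists_smul_eq_of_mem_orbit h12 k12
  obtain ⟨a, ha⟩ := exists_smul_eq_of_mem_orbit h23 k23
  obtain ⟨b, hb⟩ := exists_smul_eq_of_mem_orbit h34 k34
  obtain ⟨hg1, hg2⟩ := Prod.ext_iff.1 hg
  obtain ⟨ha2, ha3⟩ := Prod.ext_iff.1 ha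
  obtain ⟨hb3, hb4⟩ := Prod.ext_iff.1 hb
  simp only [Prod.smul_fst, Prod.smul_snd] at hg1 hg2 ha2 ha3 hb3 hb4
  -- Both `g` and `a` send `f₂` to `q₂`, and both `a` and `b` send `f₃` to `q₃`, so these quotients
  -- lie in the stabilizers.
  refine ⟨(g, ⟨g⁻¹ * a, ?_⟩, ⟨a⁻¹ * b, ?_⟩), hg1, hg2, ?_, ?_⟩
  · rw [MulAction.mem_stabilizer_iff, mul_smul, ha2, ← hg2, inv_smul_smul]
  · rw [MulAction.mem_stabilizer_iff, mul_smul, hb3, ← ha3, inv_smul_smul]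
  · simpa using ha3
  · simpa [mul_assoc] using hb4

end Chains

variable [FiniteDimensional k V] [Infinite k]

theorem isPreirreducible_S (A A' : Orbit k V n) : IsPreirreducible (S A A') := by
  rcases (S A A').eq_empty_or_nonempty with h | ⟨⟨f₁, f₃⟩, hx⟩
  · rw [h]
    exact isPreirreducible_empty
  obtain ⟨f₂, h12, h23⟩ := mem_S_iff.1 hx
  -- Repeating `f₃` as a fourth flag lets the parametrization of four-flag chains serve for three.
  have h33 : (f₃, f₃) ∈ MulAction.orbitRel.Quotient.orbit (Quotient.mk'' (f₃, f₃) : Orbit k V n) :=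
    mem_orbit_iff.2 rfl
  let _ := chainTopology f₂ f₃
  have := preirreducibleSpace_chainParam f₂ f₃
  have hrange : S A A' = (fun t : ChainParam f₂ f₃ =>
      ((t.1 • f₁, (t.1 * (t.2.1 : GLin k V)) • f₃) : FlagPair k V n)) '' Set.univ := by
    ext ⟨p, q⟩
    constructor
    · intro h
      obtain ⟨m, k12, k23⟩ := mem_S_iff.1 h
      obtain ⟨g, hg⟩ := exists_smul_eq_of_mem_orbit h23 k23
      have k33 : (q, q) ∈ MulAction.orbitRel.Quotient.orbit (Quotient.mk'' (f₃, f₃) : Orbit k V n) := by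
        have := smul_mem_orbit g h33
        rwa [Prod.smul_mk, show g • f₃ = q from congrArg Prod.snd hg] at this
      obtain ⟨t, ht1, -, ht3, -⟩ := exists_chainParam h12 h23 h33 k12 k23 k33
      exact ⟨t, trivial, Prod.ext ht1 ht3⟩
    · rintro ⟨t, -, ht⟩
      obtain ⟨k12, k23, -⟩ := chain_mem_orbits h12 h23 h33 t
      rw [← ht]
      exact mem_S_iff.2 ⟨_, k12, k23⟩
  rw [hrange]
  exact (PreirreducibleSpace.isPreirreducible_univ).image _
    (continuous_chain_one_three f₁ f₃).continuousOn

theorem IsOpenOrbit.unique {A A' C C' : Orbit k V n} (h : IsOpenOrbit A A' C)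
    (h' : IsOpenOrbit A A' C') : C = C' := by
  obtain ⟨U, hU, hUC⟩ := isOpen_induced_iff.1 h.2
  obtain ⟨U', hU', hUC'⟩ := isOpen_induced_iff.1 h'.2
  have mem : ∀ {x}, x ∈ S A A' → (x ∈ U ↔ x ∈ C.orbit) := fun {x} hx =>
    Set.ext_iff.1 hUC ⟨x, hx⟩
  have mem' : ∀ {x}, x ∈ S A A' → (x ∈ U' ↔ x ∈ C'.orbit) := fun {x} hx =>
    Set.ext_iff.1 hUC' ⟨x, hx⟩
  obtain ⟨x, hx⟩ := orbit_nonempty C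
  obtain ⟨x', hx'⟩ := orbit_nonempty C'
  obtain ⟨y, hyS, hy, hy'⟩ := isPreirreducible_S A A' U U' hU hU'
    ⟨x, h.1 hx, (mem (h.1 hx)).2 hx⟩ ⟨x', h'.1 hx', (mem' (h'.1 hx')).2 hx'⟩
  exact eq_of_mem_orbit ((mem hyS).1 hy) ((mem' hyS).1 hy')

theorem exists_isOpenOrbit {A A' : Orbit k V n} (hS : (S A A').Nonempty) :
    ∃ C, IsOpenOrbit A A' C := by
  classical
  have hmin : ∀ i j, ∃ x ∈ S A A', ∀ y ∈ S A A', relPos x i j ≤ relPos y i j := fun i j => by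
    obtain ⟨x, hx, hxm⟩ := Nat.sInf_mem (hS.image fun x => relPos x i j)
    exact ⟨x, hx, fun y hy => hxm.le.trans (Nat.sInf_le ⟨y, hy, rfl⟩)⟩
  choose m hmS hm using hmin
  let U : Fin (n + 1) × Fin (n + 1) → Set (FlagPair k V n) := fun ij =>
    {x | relPos x ij.1 ij.2 ≤ relPos (m ij.1 ij.2) ij.1 ij.2}
  have hU : ∀ ij, IsOpen (U ij) := fun ij => isOpen_relPos_le _ _ _
  -- Each entry of the relative position has its own minimizer; irreducibility yields one point `x`
  -- minimizing all entries at once.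
  obtain ⟨x, hxS, hx⟩ := isIrreducible_iff_sInter.1 ⟨hS, isPreirreducible_S A A'⟩
    (Finset.univ.image U) (by
      rintro _ hu
      obtain ⟨ij, -, rfl⟩ := Finset.mem_image.1 hu
      exact hU ij)
    (by
      rintro _ hu
      obtain ⟨ij, -, rfl⟩ := Finset.mem_image.1 hu
      exact ⟨m ij.1 ij.2, hmS _ _, le_refl (relPos (m ij.1 ij.2) ij.1 ij.2)⟩)
  have hxU : ∀ i j, relPos x i j ≤ relPos (m i j) i j := fun i j =>
    hx (U (i, j)) (by simp)
  refine ⟨Quotient.mk'' x, orbit_subset_S hxS (mem_orbit_iff.2 rfl), isOpen_induced_iff.2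
    ⟨⋂ ij, U ij, isOpen_iInter_of_finite hU, ?_⟩⟩
  ext ⟨y, hy⟩
  simp only [Set.mem_preimage, Set.mem_iInter, mem_orbit_iff, orbit_eq_iff_relPos]
  constructor
  · intro h
    funext i j
    exact le_antisymm ((h (i, j)).trans (hm i j x hxS)) ((hxU i j).trans (hm i j y hy))
  · intro h ij
    change relPos y ij.1 ij.2 ≤ _
    rw [h]
    exact hxU _ _

/-- Both ways of composing three orbits generically lead to the same orbit. -/
theorem IsOpenOrbit.assoc {A A' A'' C D C' D' : Orbit k V n} (hC : IsOpenOrbit A A' C)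
    (hD : IsOpenOrbit C A'' D) (hC' : IsOpenOrbit A' A'' C') (hD' : IsOpenOrbit A C' D') :
    D = D' := by
  have key : ∀ {B B' E : Orbit k V n}, IsOpenOrbit B B' E →
      ∃ U : Set (FlagPair k V n), IsOpen U ∧ ∀ x ∈ S B B', x ∈ U ↔ x ∈ E.orbit := by
    intro B B' E h
    obtain ⟨U, hU, hUE⟩ := isOpen_induced_iff.1 h.2
    exact ⟨U, hU, fun x hx => Set.ext_iff.1 hUE ⟨x, hx⟩⟩
  obtain ⟨U₁, hU₁, hUC⟩ := key hC
  obtain ⟨U₂, hU₂, hUD⟩ := key hD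
  obtain ⟨U₃, hU₃, hUC'⟩ := key hC'
  obtain ⟨U₄, hU₄, hUD'⟩ := key hD'
  obtain ⟨⟨f₁, f₄⟩, f14⟩ := orbit_nonempty D
  obtain ⟨f₃, f13, f34⟩ := mem_S_iff.1 (hD.1 f14)
  obtain ⟨f₂, f12, f23⟩ := mem_S_iff.1 (hC.1 f13)
  obtain ⟨⟨q₁, q₄⟩, q14⟩ := orbit_nonempty D'
  obtain ⟨q₂, q12, q24⟩ := mem_S_iff.1 (hD'.1 q14)
  obtain ⟨q₃, q23, q34⟩ := mem_S_iff.1 (hC'.1 q24)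
  obtain ⟨s, rfl, rfl, rfl, rfl⟩ := exists_chainParam f12 f23 f34 q12 q23 q34
  let _ := chainTopology f₂ f₃
  have := preirreducibleSpace_chainParam f₂ f₃
  -- The parameter `1` gives the chain `f`, which realizes `C` and `D`; the parameter `s` gives the
  -- chain `q`, which realizes `C'` and `D'`. Some `t` satisfies all four open conditions.
  obtain ⟨t, -, ⟨ht1, ht2⟩, ht3, ht4⟩ := PreirreducibleSpace.isPreirreducible_univ
    (X := ChainParam f₂ f₃) _ _
    ((hU₁.preimage (continuous_chain_one_three f₁ f₃)).inter
      (hU₂.preimage (continuous_chain_one_four f₁ f₄)))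
    ((hU₃.preimage (continuous_chain_one_four f₂ f₄)).inter
      (hU₄.preimage (continuous_chain_one_four f₁ f₄)))
    ⟨1, trivial, by simpa using (hUC _ (hC.1 f13)).2 f13, by simpa using (hUD _ (hD.1 f14)).2 f14⟩
    ⟨s, trivial, (hUC' _ (hC'.1 q24)).2 q24, (hUD' _ (hD'.1 q14)).2 q14⟩
  obtain ⟨t12, t23, t34⟩ := chain_mem_orbits f12 f23 f34 t
  have t13 := (hUC _ (mem_S_iff.2 ⟨_, t12, t23⟩)).1 ht1
  have t24 := (hUC' _ (mem_S_iff.2 ⟨_, t23, t34⟩)).1 ht3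
  exact eq_of_mem_orbit ((hUD _ (mem_S_iff.2 ⟨_, t13, t34⟩)).1 ht2)
    ((hUD' _ (mem_S_iff.2 ⟨_, t12, t24⟩)).1 ht4)

end OpenOrbits

end GenericAlgebra

namespace GenericAlgebra

/-! ### The algebra structure on the free module -/

section Product

variable {k V : Type*} [Field k] [AddCommGroup V] [Module k V] {n : ℕ}

lemma genericMul_e_e (A A' : Orbit k V n) : genericMul (e A) (e A') = starOrbit A A' := by
  simp [genericMul, e]

lemma IsOpenOrbit.nonempty_S {A A' C : Orbit k V n} (h : IsOpenOrbit A A' C) :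
    (S A A').Nonempty :=
  (orbit_nonempty C).mono h.1

lemma genericMul_e_e_of_S_eq_empty {A A' : Orbit k V n} (h : S A A' = ∅) :
    genericMul (e A) (e A') = 0 := by
  rw [genericMul_e_e, starOrbit, dif_neg]
  rintro ⟨C, hC⟩
  exact hC.nonempty_S.ne_empty h

lemma single_eq_smul_e (A : Orbit k V n) (c : ℤ) : (Finsupp.single A c : G k V n) = c • e A := by
  simp [e]

/-- The orbit `A` consists of pairs `(f, f)`. -/
def IsDiagonal (A : Orbit k V n) : Prop := ∃ f : Flag k V n, (f, f) ∈ A.orbit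

lemma IsDiagonal.eq_of_mem {A : Orbit k V n} (hA : IsDiagonal A) {p q : Flag k V n}
    (h : (p, q) ∈ A.orbit) : p = q := by
  obtain ⟨f, hf⟩ := hA
  obtain ⟨g, hg⟩ := exists_smul_eq_of_mem_orbit hf h
  exact (congrArg Prod.fst hg).symm.trans (congrArg Prod.snd hg)

lemma isOpenOrbit_of_S_eq {A A' C : Orbit k V n} (h : S A A' = C.orbit) : IsOpenOrbit A A' C := by
  refine ⟨h.ge, ?_⟩
  rw [← h, Subtype.coe_preimage_self]
  exact isOpen_univ

lemma S_eq_of_isDiagonal_left {E A : Orbit k V n} (hE : IsDiagonal E) {f f' : Flag k V n}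
    (hf : (f, f) ∈ E.orbit) (hA : (f, f') ∈ A.orbit) : S E A = A.orbit := by
  ext ⟨p, q⟩
  rw [mem_S_iff]
  constructor
  · rintro ⟨m, h1, h2⟩
    rwa [hE.eq_of_mem h1]
  · intro h
    obtain ⟨g, hg⟩ := exists_smul_eq_of_mem_orbit hA h
    have := smul_mem_orbit g hf
    rw [Prod.smul_mk, show g • f = p from congrArg Prod.fst hg] at this
    exact ⟨p, this, h⟩

lemma S_eq_of_isDiagonal_right {E A : Orbit k V n} (hE : IsDiagonal E) {f f' : Flag k V n}
    (hf : (f', f') ∈ E.orbit) (hA : (f, f') ∈ A.orbit) : S A E = A.orbit := by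
  ext ⟨p, q⟩
  rw [mem_S_iff]
  constructor
  · rintro ⟨m, h1, h2⟩
    rwa [← hE.eq_of_mem h2]
  · intro h
    obtain ⟨g, hg⟩ := exists_smul_eq_of_mem_orbit hA h
    have := smul_mem_orbit g hf
    rw [Prod.smul_mk, show g • f' = q from congrArg Prod.snd hg] at this
    exact ⟨q, h, this⟩

variable [FiniteDimensional k V] [Infinite k]

lemma IsOpenOrbit.genericMul_e_e {A A' C : Orbit k V n} (h : IsOpenOrbit A A' C) :
    genericMul (e A) (e A') = e C := by
  have hex : ∃ C, IsOpenOrbit A A' C := ⟨C, h⟩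
  rw [GenericAlgebra.genericMul_e_e, starOrbit, dif_pos hex, hex.choose_spec.unique h]

lemma genericMul_e_e_eq_zero_or (A A' : Orbit k V n) :
    genericMul (e A) (e A') = 0 ∨ ∃ C, genericMul (e A) (e A') = e C := by
  rcases (S A A').eq_empty_or_nonempty with h | h
  · exact .inl (genericMul_e_e_of_S_eq_empty h)
  · obtain ⟨C, hC⟩ := exists_isOpenOrbit h
    exact .inr ⟨C, hC.genericMul_e_e⟩

/-- Both sides are nonzero exactly when some chain of four flags has types `A`, `A'`, `A''`. In that
case `IsOpenOrbit.assoc` identifies them. -/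
lemma genericMul_assoc_e (A A' A'' : Orbit k V n) :
    genericMul (genericMul (e A) (e A')) (e A'') =
      genericMul (e A) (genericMul (e A') (e A'')) := by
  by_cases h : ∃ f₁ f₂ f₃ f₄ : Flag k V n,
      (f₁, f₂) ∈ A.orbit ∧ (f₂, f₃) ∈ A'.orbit ∧ (f₃, f₄) ∈ A''.orbit
  · obtain ⟨f₁, f₂, f₃, f₄, h12, h23, h34⟩ := h
    obtain ⟨C, hC⟩ := exists_isOpenOrbit ⟨_, mem_S_iff.2 ⟨_, h12, h23⟩⟩
    obtain ⟨C', hC'⟩ := exists_isOpenOrbit ⟨_, mem_S_iff.2 ⟨_, h23, h34⟩⟩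
    -- A pair in `C` need not be `(f₁, f₃)`, but its second flag is a translate of `f₃`, so the pair
    -- `(f₃, f₄)` can be moved to continue it.
    have hS : (S C A'').Nonempty := by
      obtain ⟨⟨q₁, q₃⟩, q13⟩ := orbit_nonempty C
      obtain ⟨q₂, -, q23⟩ := mem_S_iff.1 (hC.1 q13)
      obtain ⟨g, hg⟩ := exists_smul_eq_of_mem_orbit h23 q23
      have := smul_mem_orbit g h34
      rw [Prod.smul_mk, show g • f₃ = q₃ from congrArg Prod.snd hg] at this
      exact ⟨_, mem_S_iff.2 ⟨_, q13, this⟩⟩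
    have hS' : (S A C').Nonempty := by
      obtain ⟨⟨q₂, q₄⟩, q24⟩ := orbit_nonempty C'
      obtain ⟨q₃, q23, -⟩ := mem_S_iff.1 (hC'.1 q24)
      obtain ⟨g, hg⟩ := exists_smul_eq_of_mem_orbit h23 q23
      have := smul_mem_orbit g h12
      rw [Prod.smul_mk, show g • f₂ = q₂ from congrArg Prod.fst hg] at this
      exact ⟨_, mem_S_iff.2 ⟨_, this, q24⟩⟩
    obtain ⟨D, hD⟩ := exists_isOpenOrbit hS
    obtain ⟨D', hD'⟩ := exists_isOpenOrbit hS'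
    rw [hC.genericMul_e_e, hC'.genericMul_e_e, hD.genericMul_e_e, hD'.genericMul_e_e,
      hC.assoc hD hC' hD']
  · have hl : genericMul (genericMul (e A) (e A')) (e A'') = 0 := by
      rcases (S A A').eq_empty_or_nonempty with h0 | h0
      · rw [genericMul_e_e_of_S_eq_empty h0, map_zero, LinearMap.zero_apply]
      · obtain ⟨C, hC⟩ := exists_isOpenOrbit h0
        rw [hC.genericMul_e_e]
        refine genericMul_e_e_of_S_eq_empty (Set.eq_empty_of_forall_notMem ?_)
        rintro ⟨q₁, q₄⟩ hq
        obtain ⟨q₃, q13, q34⟩ := mem_S_iff.1 hq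
        obtain ⟨q₂, q12, q23⟩ := mem_S_iff.1 (hC.1 q13)
        exact h ⟨q₁, q₂, q₃, q₄, q12, q23, q34⟩
    have hr : genericMul (e A) (genericMul (e A') (e A'')) = 0 := by
      rcases (S A' A'').eq_empty_or_nonempty with h0 | h0
      · rw [genericMul_e_e_of_S_eq_empty h0, map_zero]
      · obtain ⟨C, hC⟩ := exists_isOpenOrbit h0
        rw [hC.genericMul_e_e]
        refine genericMul_e_e_of_S_eq_empty (Set.eq_empty_of_forall_notMem ?_)
        rintro ⟨q₁, q₄⟩ hq
        obtain ⟨q₂, q12, q24⟩ := mem_S_iff.1 hq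
        obtain ⟨q₃, q23, q34⟩ := mem_S_iff.1 (hC.1 q24)
        exact h ⟨q₁, q₂, q₃, q₄, q12, q23, q34⟩
    rw [hl, hr]

theorem genericMul_assoc (x y z : G k V n) :
    genericMul (genericMul x y) z = genericMul x (genericMul y z) := by
  induction x using Finsupp.induction_linear with
  | zero => simp
  | add x x' hx hx' => simp only [map_add, LinearMap.add_apply, hx, hx']
  | single A a =>
  induction y using Finsupp.induction_linear with
  | zero => simp
  | add y y' hy hy' => simp only [map_add, LinearMap.add_apply, hy, hy']
  | single A' b =>
  induction z using Finsupp.induction_linear with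
  | zero => simp
  | add z z' hz hz' => simp only [map_add, hz, hz']
  | single A'' c =>
    simp only [single_eq_smul_e, map_smul, LinearMap.smul_apply, genericMul_assoc_e]

/-- The sum of the diagonal orbits. -/
noncomputable def genericOne (k V : Type*) [Field k] [AddCommGroup V] [Module k V]
    [FiniteDimensional k V] (n : ℕ) : G k V n :=
  ∑ A ∈ (Set.toFinite {A : Orbit k V n | IsDiagonal A}).toFinset, e A

/-- Only the diagonal orbit through the first flag of a pair in `A` composes with `A`, and that
composite is all of `A`; the other terms of the sum vanish. -/
lemma genericOne_mul_e (A : Orbit k V n) : genericMul (genericOne k V n) (e A) = e A := by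
  obtain ⟨⟨f, f'⟩, hA⟩ := orbit_nonempty A
  let E : Orbit k V n := Quotient.mk'' (f, f)
  have hf : (f, f) ∈ MulAction.orbitRel.Quotient.orbit E := mem_orbit_iff.2 rfl
  have hE : IsDiagonal E := ⟨f, hf⟩
  rw [genericOne, map_sum, LinearMap.sum_apply, Finset.sum_eq_single E]
  · exact (isOpenOrbit_of_S_eq (S_eq_of_isDiagonal_left hE hf hA)).genericMul_e_e
  · intro B hB hBE
    have hB' : IsDiagonal B := by simpa using hB
    refine genericMul_e_e_of_S_eq_empty (Set.eq_empty_of_forall_notMem ?_)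
    rintro ⟨p, q⟩ h
    obtain ⟨m, h1, h2⟩ := mem_S_iff.1 h
    obtain rfl := hB'.eq_of_mem h1
    obtain ⟨g, hg⟩ := exists_smul_eq_of_mem_orbit hA h2
    have := smul_mem_orbit g hf
    rw [Prod.smul_mk, show g • f = p from congrArg Prod.fst hg] at this
    exact hBE (eq_of_mem_orbit h1 this)
  · intro h
    exact absurd hE (by simpa using h)

lemma e_mul_genericOne (A : Orbit k V n) : genericMul (e A) (genericOne k V n) = e A := by
  obtain ⟨⟨f, f'⟩, hA⟩ := orbit_nonempty A
  let E : Orbit k V n := Quotient.mk'' (f', f')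
  have hf : (f', f') ∈ MulAction.orbitRel.Quotient.orbit E := mem_orbit_iff.2 rfl
  have hE : IsDiagonal E := ⟨f', hf⟩
  rw [genericOne, map_sum, Finset.sum_eq_single E]
  · exact (isOpenOrbit_of_S_eq (S_eq_of_isDiagonal_right hE hf hA)).genericMul_e_e
  · intro B hB hBE
    have hB' : IsDiagonal B := by simpa using hB
    refine genericMul_e_e_of_S_eq_empty (Set.eq_empty_of_forall_notMem ?_)
    rintro ⟨p, q⟩ h
    obtain ⟨m, h1, h2⟩ := mem_S_iff.1 h
    obtain rfl := hB'.eq_of_mem h2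
    obtain ⟨g, hg⟩ := exists_smul_eq_of_mem_orbit hA h1
    have := smul_mem_orbit g hf
    rw [Prod.smul_mk, show g • f' = m from congrArg Prod.snd hg] at this
    exact hBE (eq_of_mem_orbit h2 this)
  · intro h
    exact absurd hE (by simpa using h)

theorem genericOne_mul (x : G k V n) : genericMul (genericOne k V n) x = x := by
  induction x using Finsupp.induction_linear with
  | zero => simp
  | add x y hx hy => rw [map_add, hx, hy]
  | single A c => rw [single_eq_smul_e, map_smul, genericOne_mul_e]

theorem mul_genericOne (x : G k V n) : genericMul x (genericOne k V n) = x := by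
  induction x using Finsupp.induction_linear with
  | zero => simp
  | add x y hx hy => rw [map_add, LinearMap.add_apply, hx, hy]
  | single A c => rw [single_eq_smul_e, map_smul, LinearMap.smul_apply, e_mul_genericOne]

end Product

end GenericAlgebra

theorem mainTheorem4 {k V : Type*} [Field k] [IsAlgClosed k] [AddCommGroup V] [Module k V]
    [FiniteDimensional k V] (n r : ℕ) (hn : 1 ≤ n) (hr : 1 ≤ r)
    (hV : Module.finrank k V = r) :
    -- closures are irreducible, and there is a unique open orbit
    (∀ A A' : Orbit k V n, (S A A').Nonempty →
      IsIrreducible (closure (S A A')) ∧ ∃! C, IsOpenOrbit A A' C) ∧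
    -- the product of two orbits is the open orbit, or zero
    (∀ A A' C : Orbit k V n, IsOpenOrbit A A' C →
      genericMul (e A) (e A') = e C) ∧
    (∀ A A' : Orbit k V n, S A A' = ∅ →
      genericMul (e A) (e A') = 0) ∧
    -- the bilinear product is associative and has an identity
    (∀ x y z : G k V n,
      genericMul (genericMul x y) z =
        genericMul x (genericMul y z)) ∧
    (∃ u : G k V n, ∀ x : G k V n,
      genericMul u x = x ∧ genericMul x u = x) ∧
    -- the orbits are a multiplicative basis
    (∃ b : Module.Basis (Orbit k V n) ℤ (G k V n), (∀ A, b A = e A) ∧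
      ∀ A A' : Orbit k V n, genericMul (b A) (b A') = 0 ∨
        ∃ C, genericMul (b A) (b A') = b C) := by
  have : Infinite k := IsAlgClosed.instInfinite
  refine ⟨fun A A' hS => ⟨IsIrreducible.closure ⟨hS, isPreirreducible_S A A'⟩, ?_⟩,
    fun A A' C h => h.genericMul_e_e, fun A A' h => genericMul_e_e_of_S_eq_empty h,
    genericMul_assoc, ⟨genericOne k V n, fun x => ⟨genericOne_mul x, mul_genericOne x⟩⟩,
    ⟨Finsupp.basisSingleOne, fun A => by simp [e], fun A A' => ?_⟩⟩
  · obtain ⟨C, hC⟩ := exists_isOpenOrbit hS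
    exact ⟨C, hC, fun C' hC' => hC'.unique hC⟩
  · simpa [e] using genericMul_e_e_eq_zero_or A A'
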